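/- Let \(T_7(x)=64x^7-112x^5+56x^3-7x\) be the seventh Chebyshev polynomial of the first kind and put \[ G_7(x;u,v)=S^{7/2}\,T_7\!\bigl(x/\sqrt{S}\bigr)-u\,S^3 =64x^7-112Sx^5+56S^2x^3-7S^3x-uS^3,\qquad S=u^2+7v^2 . \] Let \(C_7\rtimes C_3\) denote the non-abelian group of order \(21\), a generator of \(C_3\) acting on \(C_7\) by \(g\mapsto g^2\). Call a subset of \(\mathbb{Q}^2\) thin if it is covered by finitely many sets, each of which is either contained in a proper Zariski-closed subset of the affine plane \(\mathbb{A}^2_{\mathbb{Q}}\), or contained in \(\pi(W(\mathbb{Q}))\) for some irreducible \(\mathbb{Q}\)-variety \(W\) and some dominant generically finite morphism \(\pi:W\to\mathbb{A}^2_{\mathbb{Q}}\) of degree at least \(2\). 1. Over the rational function field \(\mathbb{Q}(u,v)\), the Galois group of (a splitting field of) \(G_7(x;u,v)\) is isomorphic to \(C_7\rtimes C_3\). 2. There is a thin set \(Z\subset\mathbb{Q}^2\) such that for all coprime integers \(r,s\) with \(7\nmid rs\) and \((r,s)\notin Z\), the polynomial \(G_7(x;r,s)\in\mathbb{Q}[x]\)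 is irreducible over \(\mathbb{Q}\) and its Galois group over \(\mathbb{Q}\) is isomorphic to \(C_7\rtimes C_3\). 3. There are infinitely many pairwise non-isomorphic number fields of degree \(7\) over \(\mathbb{Q}\) whose Galois closures over \(\mathbb{Q}\) have Galois group isomorphic to \(C_7\rtimes C_3\); they can be chosen so that each is generated by a root of \(G_7(x;r,s)\) for some coprime integers \(r,s\) with \(7\nmid rs\). -/

import Mathlib

open Polynomial

/-- The polynomial `S ^ (n / 2) * T_n (X / √S)` built from the Chebyshev polynomial of the first
kind `T_n`. Only monomials `X ^ j` with `j ≡ n (mod 2)` occur in `T_n`, so `X ^ j` receives the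
factor `S ^ ((n - j) / 2)` with an integral exponent; see `eval_scaledChebyshev_seven`. -/
noncomputable def scaledChebyshev {R : Type*} [CommRing R] (n : ℕ) (S : R) : R[X] :=
  ∑ j ∈ Finset.range (n + 1), C ((Chebyshev.T R n).coeff j * S ^ ((n - j) / 2)) * X ^ j

/-- `G₇(x; u, v) = S ^ (7/2) * T₇ (x / √S) - u * S ^ 3`, where `S = u ^ 2 + 7 * v ^ 2`. -/
noncomputable def chebyshevSeptic {R : Type*} [CommRing R] (u v : R) : R[X] :=
  scaledChebyshev 7 (u ^ 2 + 7 * v ^ 2) - C (u * (u ^ 2 + 7 * v ^ 2) ^ 3)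

theorem chebyshev_T_seven (R : Type*) [CommRing R] :
    Chebyshev.T R 7 = C 64 * X ^ 7 + C (-112) * X ^ 5 + C 56 * X ^ 3 + C (-7) * X := by
  have h : ∀ n : ℤ, Chebyshev.T R (n + 2) = 2 * X * Chebyshev.T R (n + 1) - Chebyshev.T R n :=
    Chebyshev.T_add_two R
  have h2 := h 0
  have h3 := h 1
  have h4 := h 2
  have h5 := h 3
  have h6 := h 4
  have h7 := h 5
  norm_num at h2 h3 h4 h5 h6 h7
  rw [h7, h6, h5, h4, h3, h2]
  have e1 : (C (64 : R) : R[X]) = 64 := rfl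
  have e2 : (C (-112 : R) : R[X]) = -112 := by rw [C_neg]; rfl
  have e3 : (C (56 : R) : R[X]) = 56 := rfl
  have e4 : (C (-7 : R) : R[X]) = -7 := by rw [C_neg]; rfl
  rw [e1, e2, e3, e4]
  ring

theorem scaledChebyshev_seven {R : Type*} [CommRing R] (S : R) :
    scaledChebyshev 7 S =
      C 64 * X ^ 7 - C (112 * S) * X ^ 5 + C (56 * S ^ 2) * X ^ 3 - C (7 * S ^ 3) * X := by
  have h : Chebyshev.T R ((7 : ℕ) : ℤ) = _ := chebyshev_T_seven R
  unfold scaledChebyshev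
  rw [h]
  simp only [Finset.sum_range_succ, Finset.sum_range_zero, coeff_add, coeff_C_mul, coeff_X_pow,
    coeff_X]
  norm_num
  ring

/-- If `σ` is a nonzero square root of `S`, then `scaledChebyshev 7 S` takes the value
`σ ^ 7 * T₇ (x / σ)` at `x`. -/
theorem eval_scaledChebyshev_seven {F : Type*} [Field F] (S σ x : F) (hσ : σ ^ 2 = S)
    (h0 : σ ≠ 0) :
    (scaledChebyshev 7 S).eval x = σ ^ 7 * (Chebyshev.T F 7).eval (x / σ) := by
  rw [scaledChebyshev_seven, chebyshev_T_seven, ← hσ]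
  simp only [eval_add, eval_sub, eval_mul, eval_C, eval_pow, eval_X]
  field_simp
  ring

/-- The action of `C₃` on `C₇` in which the generator of `C₃` acts on `ZMod 7` as multiplication
by `2`, an element of multiplicative order `3`. -/
def c3ActionOnC7 : Multiplicative (ZMod 3) →* MulAut (Multiplicative (ZMod 7)) where
  toFun k :=
    { toFun := fun x => Multiplicative.ofAdd (2 ^ (k.toAdd.val) * x.toAdd)
      invFun := fun x => Multiplicative.ofAdd (4 ^ (k.toAdd.val) * x.toAdd)
      left_inv := by revert k; decide
      right_inv := by revert k; decide
      map_mul' := by revert k; decide }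
  map_one' := by decide
  map_mul' := by decide

/-- The Frobenius group `C₇ ⋊ C₃` of order `21`. -/
abbrev C7C3 : Type := Multiplicative (ZMod 7) ⋊[c3ActionOnC7] Multiplicative (ZMod 3)

/-- A set of rational points of affine space lying on a proper Zariski-closed subset. -/
def IsThinTypeOne {k σ : Type} [Field k] (Z : Set (σ → k)) : Prop :=
  ∃ p : MvPolynomial σ k, p ≠ 0 ∧ ∀ t ∈ Z, MvPolynomial.eval t p = 0

/-- A set of rational points of affine space contained in `π (W (k))` for some integral affine
`k`-variety `W = Spec A` and some dominant morphism `π` from `W` to affine space of finite degree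
`≥ 2`: `π` is given by `φ`, dominance is injectivity of `φ`, the degree is that of the extension
of function fields, and a rational point of `W` is a `k`-algebra homomorphism `A → k`, whose image
under `π` is the point with coordinates `P (φ (X i))`. (A general variety `W` is a finite union of
open affine ones, so nothing is lost in finite unions by taking `W` affine.) -/
def IsThinTypeTwo {k σ : Type} [Field k] (Z : Set (σ → k)) : Prop :=
  ∃ (A : Type) (_ : CommRing A) (_ : IsDomain A) (_ : Algebra k A) (φ : MvPolynomial σ k →ₐ[k] A)
    (hφ : Function.Injective φ),
    Algebra.FiniteType k A ∧
    (letI : Algebra (FractionRing (MvPolynomial σ k)) (FractionRing A) :=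
      (IsFractionRing.map (K := FractionRing (MvPolynomial σ k)) (L := FractionRing A)
        (j := φ.toRingHom) hφ).toAlgebra
     2 ≤ Module.finrank (FractionRing (MvPolynomial σ k)) (FractionRing A)) ∧
    ∀ t ∈ Z, ∃ P : A →ₐ[k] k, ∀ i, P (φ (MvPolynomial.X i)) = t i

/-- Thin subsets of affine space over `k` (in the sense of Serre): those covered by finitely many
sets of the two types above. -/
def IsThin {k σ : Type} [Field k] (Z : Set (σ → k)) : Prop :=
  ∃ F : Set (Set (σ → k)), F.Finite ∧ (∀ Y ∈ F, IsThinTypeOne Y ∨ IsThinTypeTwo Y) ∧ Z ⊆ ⋃₀ F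

/-- The field `ℚ(u, v)` of rational functions in two variables. -/
abbrev RatFunUV : Type := FractionRing (MvPolynomial (Fin 2) ℚ)

/-- The variable `u`. -/
noncomputable def varU : RatFunUV := algebraMap (MvPolynomial (Fin 2) ℚ) RatFunUV (MvPolynomial.X 0)

/-- The variable `v`. -/
noncomputable def varV : RatFunUV := algebraMap (MvPolynomial (Fin 2) ℚ) RatFunUV (MvPolynomial.X 1)

/-! Let `w² = -7`, `α = u + w v`, `α' = u - w v`, so that `S = α α'`. If `y ^ 7 = α ^ 4 α' ^ 3` and
`y z = S`, then `z ^ 7 = α ^ 3 α' ^ 4` and `y ^ 7 + z ^ 7 = 2 u S ^ 3`. The Chebyshev identity then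
makes the seven numbers `(ζ ^ k y + ζ ^ (-k) z) / 2` the roots (`eval_septicRoot`). Take `w` to be
the Gauss sum of `ζ`. An automorphism with `ζ ↦ ζ ^ e` fixes `w` and multiplies `y` by a root of
unity when `e` is a square mod 7; otherwise it negates `w` and interchanges `y` and `z` up to roots
of unity. Since -1 is not a square mod 7, either way the index moves by `k ↦ c k + j` with `c` a
square (`exists_map_septicRoot`), so the Galois group embeds in `C₇ ⋊ C₃`. Irreducibility supplies
the factor 7 of its order. The factor 3 comes from `ζ + ζ⁻¹`, a ratio built from the roots, whenever
its cubic is irreducible over the base. As the order divides 21, the septic is irreducible once it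
has no root in the base field. The exceptional parameters are thus those with a rational root, a
thin set because the generic septic is irreducible. For infinitely many fields, a prime `p` exactly
dividing `r ^ 2 + 7` excludes roots in `ℚ_p`, while for suitable `p` not dividing `r ^ 2 + 7`
Hensel's lemma gives one. A sequence of such pairs `(p, r)` separates the fields. -/

theorem chebyshevSeptic_eq {R : Type*} [CommRing R] (u v : R) :
    chebyshevSeptic u v =
      C 64 * X ^ 7 - C (112 * (u ^ 2 + 7 * v ^ 2)) * X ^ 5 +
        C (56 * (u ^ 2 + 7 * v ^ 2) ^ 2) * X ^ 3 - C (7 * (u ^ 2 + 7 * v ^ 2) ^ 3) * X -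
        C (u * (u ^ 2 + 7 * v ^ 2) ^ 3) := by
  rw [chebyshevSeptic, scaledChebyshev_seven]

theorem map_chebyshevSeptic {R R' : Type*} [CommRing R] [CommRing R'] (φ : R →+* R') (u v : R) :
    (chebyshevSeptic u v).map φ = chebyshevSeptic (φ u) (φ v) := by
  simp only [chebyshevSeptic_eq, Polynomial.map_add, Polynomial.map_sub, Polynomial.map_mul,
    Polynomial.map_pow, map_C, map_X, RingHom.map_mul φ, RingHom.map_add φ, RingHom.map_pow φ,
    map_ofNat φ]

theorem eval_chebyshevSeptic {R : Type*} [CommRing R] (u v x : R) :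
    (chebyshevSeptic u v).eval x =
      64 * x ^ 7 - 112 * (u ^ 2 + 7 * v ^ 2) * x ^ 5 + 56 * (u ^ 2 + 7 * v ^ 2) ^ 2 * x ^ 3 -
        7 * (u ^ 2 + 7 * v ^ 2) ^ 3 * x - u * (u ^ 2 + 7 * v ^ 2) ^ 3 := by
  simp only [chebyshevSeptic_eq, eval_add, eval_sub, eval_mul, eval_C, eval_pow, eval_X]

theorem aeval_chebyshevSeptic {R A : Type*} [CommRing R] [CommRing A] [Algebra R A] (u v : R)
    (x : A) :
    aeval x (chebyshevSeptic u v) =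
      (chebyshevSeptic (algebraMap R A u) (algebraMap R A v)).eval x := by
  rw [aeval_def, eval₂_eq_eval_map, map_chebyshevSeptic]

theorem natDegree_chebyshevSeptic {F : Type*} [Field F] [CharZero F] (u v : F) :
    (chebyshevSeptic u v).natDegree = 7 := by
  rw [chebyshevSeptic_eq]
  compute_degree!

theorem chebyshevSeptic_ne_zero {F : Type*} [Field F] [CharZero F] (u v : F) :
    chebyshevSeptic u v ≠ 0 := fun h => by
  have := natDegree_chebyshevSeptic u v
  simp [h] at this

theorem eval_half_add_chebyshevSeptic {F : Type*} [Field F] [CharZero F] {u v a b : F}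
    (h : a * b = u ^ 2 + 7 * v ^ 2) :
    (chebyshevSeptic u v).eval ((a + b) / 2) =
      (a ^ 7 + b ^ 7) / 2 - u * (u ^ 2 + 7 * v ^ 2) ^ 3 := by
  rw [eval_chebyshevSeptic, ← h]
  ring

/-! ### Explicit roots and the action of automorphisms on them -/

/-- The seven values `(ψ k * y + ψ (-k) * z) / 2`, for an additive character `ψ` of `ℤ/7`. -/
def septicRoot {L : Type*} [Field L] (ψ : AddChar (ZMod 7) L) (y z : L) (k : ZMod 7) : L :=
  (ψ k * y + ψ (-k) * z) / 2

section

variable {L : Type*} [Field L] {ψ : AddChar (ZMod 7) L}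

theorem addChar_pow_seven (ψ : AddChar (ZMod 7) L) (k : ZMod 7) : ψ k ^ 7 = 1 := by
  rw [← AddChar.map_nsmul_eq_pow]
  have : (7 : ℕ) • k = 0 := by revert k; decide
  rw [this, AddChar.map_zero_eq_one]

theorem addChar_mul_neg (ψ : AddChar (ZMod 7) L) (k : ZMod 7) : ψ k * ψ (-k) = 1 := by
  rw [← AddChar.map_add_eq_mul, add_neg_cancel, AddChar.map_zero_eq_one]

theorem exists_addChar_of_pow_seven (hψ : Function.Injective ψ) {x : L} (hx : x ^ 7 = 1) :
    ∃ j, x = ψ j := by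
  have hp : IsPrimitiveRoot (ψ 1) 7 := by
    refine IsPrimitiveRoot.mk_of_lt _ (by norm_num) (addChar_pow_seven ψ 1) fun l h0 h7 h => ?_
    rw [← AddChar.map_nsmul_eq_pow, ← ψ.map_zero_eq_one] at h
    have := hψ h
    interval_cases l <;> revert this <;> decide
  obtain ⟨i, -, rfl⟩ := hp.eq_pow_of_pow_eq_one hx
  exact ⟨i • 1, (AddChar.map_nsmul_eq_pow _ _ _).symm⟩

theorem eval_septicRoot [CharZero L] {u v y z : L} (h : y * z = u ^ 2 + 7 * v ^ 2)
    (h7 : y ^ 7 + z ^ 7 = 2 * u * (u ^ 2 + 7 * v ^ 2) ^ 3) (k : ZMod 7) :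
    (chebyshevSeptic u v).eval (septicRoot ψ y z k) = 0 := by
  have hk := addChar_mul_neg ψ k
  rw [septicRoot, eval_half_add_chebyshevSeptic (by linear_combination y * z * hk + h), mul_pow,
    mul_pow, addChar_pow_seven, addChar_pow_seven]
  linear_combination h7 / 2

/-- Twice the difference of two values factors as `(ψ i - ψ j) * (y - ψ (-i) * ψ (-j) * z)`, and the
vanishing of the second factor would force `y ^ 7 = z ^ 7`. -/
theorem septicRoot_injective [CharZero L] {y z : L} (hψ : Function.Injective ψ)
    (h : y ^ 7 ≠ z ^ 7) : Function.Injective (septicRoot ψ y z) := by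
  intro i j hij
  simp only [septicRoot] at hij
  have h1 : (ψ i - ψ j) * (y - ψ (-i) * ψ (-j) * z) = 0 := by
    linear_combination 2 * hij - z * ψ (-j) * addChar_mul_neg ψ i
      + z * ψ (-i) * addChar_mul_neg ψ j
  rcases mul_eq_zero.1 h1 with h1 | h1
  · exact hψ (sub_eq_zero.1 h1)
  · refine absurd ?_ h
    rw [sub_eq_zero.1 h1, mul_pow, mul_pow, addChar_pow_seven, addChar_pow_seven, one_mul, one_mul]

/-- The quadratic Gauss sum of `ψ`. -/
def gaussSumSeven (ψ : AddChar (ZMod 7) L) : L := ψ 1 + ψ 2 + ψ 4 - ψ 3 - ψ 5 - ψ 6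

theorem addChar_eq_pow (ψ : AddChar (ZMod 7) L) :
    ψ 2 = ψ 1 ^ 2 ∧ ψ 3 = ψ 1 ^ 3 ∧ ψ 4 = ψ 1 ^ 4 ∧ ψ 5 = ψ 1 ^ 5 ∧ ψ 6 = ψ 1 ^ 6 := by
  simp only [← AddChar.map_nsmul_eq_pow]
  exact ⟨rfl, rfl, rfl, rfl, rfl⟩

theorem addChar_sum_eq_zero (hψ : Function.Injective ψ) :
    1 + ψ 1 + ψ 1 ^ 2 + ψ 1 ^ 3 + ψ 1 ^ 4 + ψ 1 ^ 5 + ψ 1 ^ 6 = 0 := by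
  have h1 : ψ 1 - 1 ≠ 0 := fun h => by
    have := hψ ((sub_eq_zero.1 h).trans ψ.map_zero_eq_one.symm)
    revert this; decide
  refine (mul_eq_zero.1 ?_).resolve_left h1
  linear_combination addChar_pow_seven ψ 1

theorem gaussSumSeven_sq (hψ : Function.Injective ψ) : gaussSumSeven ψ ^ 2 = -7 := by
  obtain ⟨h2, h3, h4, h5, h6⟩ := addChar_eq_pow ψ
  have h7 := addChar_pow_seven ψ 1
  have hs := addChar_sum_eq_zero hψ
  rw [gaussSumSeven, h2, h3, h4, h5, h6]
  generalize ψ 1 = t at *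
  -- The vanishing sum of all powers of `t` eliminates the nonresidues in favour of the residues 1,
  -- 2, 4.
  have e : (t + t ^ 2 + t ^ 4 - t ^ 3 - t ^ 5 - t ^ 6) =
      1 + 2 * (t + t ^ 2 + t ^ 4) := by linear_combination -hs
  rw [e]
  linear_combination 8 * hs + 4 * t * h7

theorem addChar_real_root (hψ : Function.Injective ψ) :
    (ψ 1 + ψ (-1)) ^ 3 + (ψ 1 + ψ (-1)) ^ 2 - 2 * (ψ 1 + ψ (-1)) - 1 = 0 := by
  have h6 : ψ (-1) = ψ 1 ^ 6 := (addChar_eq_pow ψ).2.2.2.2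
  have h7 := addChar_pow_seven ψ 1
  have hs := addChar_sum_eq_zero hψ
  rw [h6]
  generalize ψ 1 = t at *
  linear_combination hs + (3 * t + 3 * t ^ 6 + t ^ 4 * (t ^ 7 + 1) + 2 + t ^ 5) * h7

/-- A ring endomorphism acts on the values of a faithful character of `ℤ/7` through a
multiplication. -/
theorem exists_map_addChar (hψ : Function.Injective ψ) (τ : L →+* L) :
    ∃ e : ZMod 7, e ≠ 0 ∧ ∀ k, τ (ψ k) = ψ (e * k) := by
  obtain ⟨e, he⟩ := exists_addChar_of_pow_seven hψ (x := τ (ψ 1))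
    (by rw [← map_pow, addChar_pow_seven, map_one])
  have key : ∀ k, τ (ψ k) = ψ (e * k) := fun k => by
    obtain ⟨n, rfl⟩ := ZMod.natCast_zmod_surjective k
    rw [← nsmul_one n, AddChar.map_nsmul_eq_pow, map_pow, he, mul_smul_comm, mul_one,
      AddChar.map_nsmul_eq_pow]
  refine ⟨e, ?_, key⟩
  rintro rfl
  have h := key 1
  rw [zero_mul, ψ.map_zero_eq_one, map_eq_one_iff _ τ.injective, ← ψ.map_zero_eq_one] at h
  have := hψ h
  revert this; decide

/-- A ring endomorphism fixing `u` and `v` permutes the seven roots through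
`k ↦ c * k + j` with `c` a square. -/
theorem exists_map_septicRoot [CharZero L] {u v y z : L} (hψ : Function.Injective ψ)
    (h : y * z = u ^ 2 + 7 * v ^ 2) (hS : u ^ 2 + 7 * v ^ 2 ≠ 0)
    (hy : y ^ 7 = (u + gaussSumSeven ψ * v) ^ 4 * (u - gaussSumSeven ψ * v) ^ 3)
    (hz : z ^ 7 = (u + gaussSumSeven ψ * v) ^ 3 * (u - gaussSumSeven ψ * v) ^ 4)
    (τ : L →+* L) (hu : τ u = u) (hv : τ v = v) :
    ∃ (i : ZMod 3) (j : ZMod 7),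
      ∀ k, τ (septicRoot ψ y z k) = septicRoot ψ y z (j + 2 ^ i.val * k) := by
  obtain ⟨e, he0, he⟩ := exists_map_addChar hψ τ
  have hyz : y * z ≠ 0 := h ▸ hS
  have hy0 : y ≠ 0 := left_ne_zero_of_mul hyz
  have hτ : τ y * τ z = y * z := by 
    rw [← map_mul, h, map_add, map_mul, map_pow, map_pow, hu, hv, map_ofNat]
  -- The squares mod 7 are the powers of 2, and the nonsquares are their negatives.
  have hcases : (∃ i : ZMod 3, e = 2 ^ i.val) ∨ ∃ i : ZMod 3, e = -2 ^ i.val := by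
    clear he
    revert e
    decide
  rcases hcases with ⟨i, rfl⟩ | ⟨i, rfl⟩
  · have hw : τ (gaussSumSeven ψ) = gaussSumSeven ψ := by
      simp only [gaussSumSeven, map_add, map_sub, he]
      have : i = 0 ∨ i = 1 ∨ i = 2 := by clear he he0; revert i; decide
      rcases this with rfl | rfl | rfl
      · rfl
      · change ψ 2 + ψ 4 + ψ 1 - ψ 6 - ψ 3 - ψ 5 = _; ring
      · change ψ 4 + ψ 1 + ψ 2 - ψ 5 - ψ 6 - ψ 3 = _; ring
    -- As `w` is fixed, so is `y ^ 7`; hence `τ y / y` is a seventh root of unity.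
    obtain ⟨j, hj⟩ := exists_addChar_of_pow_seven hψ (x := τ y / y) (by
      rw [div_pow, ← map_pow, hy]
      simp only [map_mul, map_pow, map_add, map_sub, hw, hu, hv]
      rw [← hy, div_self (pow_ne_zero _ hy0)])
    have hty : τ y = ψ j * y := by rw [← hj, div_mul_cancel₀ _ hy0]
    have htz : τ z = ψ (-j) * z := by
      rw [hty] at hτ
      have := addChar_mul_neg ψ j
      refine mul_left_cancel₀ hy0 ?_
      linear_combination ψ (-j) * hτ - y * τ z * this
    refine ⟨i, j, fun k => ?_⟩
    simp only [septicRoot, map_div₀, map_add, map_mul, he, hty, htz, map_ofNat, neg_add,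
      AddChar.map_add_eq_mul, mul_neg]
    ring
  · have hw : τ (gaussSumSeven ψ) = -gaussSumSeven ψ := by
      simp only [gaussSumSeven, map_add, map_sub, he]
      have : i = 0 ∨ i = 1 ∨ i = 2 := by clear he he0; revert i; decide
      rcases this with rfl | rfl | rfl
      · change ψ 6 + ψ 5 + ψ 3 - ψ 4 - ψ 2 - ψ 1 = _; ring
      · change ψ 5 + ψ 3 + ψ 6 - ψ 1 - ψ 4 - ψ 2 = _; ring
      · change ψ 3 + ψ 6 + ψ 5 - ψ 2 - ψ 1 - ψ 4 = _; ring
    -- Negating `w` interchanges `y ^ 7` and `z ^ 7`, so now `τ z` is compared with `y`. The two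
    -- signs, in `e` and in the swap, cancel in the index.
    obtain ⟨j, hj⟩ := exists_addChar_of_pow_seven hψ (x := τ z / y) (by
      rw [div_pow, ← map_pow, hz]
      simp only [map_mul, map_pow, map_add, map_sub, hw, hu, hv]
      rw [hy, div_eq_one_iff_eq (hy ▸ pow_ne_zero _ hy0)]
      ring)
    have htz : τ z = ψ j * y := by rw [← hj, div_mul_cancel₀ _ hy0]
    have hty : τ y = ψ (-j) * z := by
      rw [htz] at hτ
      have := addChar_mul_neg ψ j
      refine mul_left_cancel₀ hy0 ?_
      linear_combination ψ (-j) * hτ - y * τ y * this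
    refine ⟨i, j, fun k => ?_⟩
    simp only [septicRoot, map_div₀, map_add, map_mul, he, hty, htz, map_ofNat, neg_add,
      AddChar.map_add_eq_mul, mul_neg, neg_mul, neg_neg]
    ring

end

theorem exists_injective_addChar_seven (L : Type*) [Field L] [CharZero L] [IsAlgClosed L] :
    ∃ ψ : AddChar (ZMod 7) L, Function.Injective ψ := by
  obtain ⟨ζ, hζ⟩ := IsAlgClosed.exists_root (cyclotomic 7 L) (by
    rw [degree_cyclotomic]; decide)
  have hp : IsPrimitiveRoot ζ 7 := isRoot_cyclotomic_iff.1 hζ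
  refine ⟨AddChar.zmodChar 7 hp.pow_eq_one, fun a b hab => ?_⟩
  simp only [AddChar.zmodChar_apply] at hab
  exact ZMod.val_injective 7 (hp.pow_inj a.val_lt b.val_lt hab)

/-! ### The affine group of order 21 and irreducibility of septics -/

/-- The action of `C₇ ⋊ C₃` on `ℤ/7` by affine maps. -/
def C7C3.act (g : C7C3) (k : ZMod 7) : ZMod 7 := g.left.toAdd + 2 ^ g.right.toAdd.val * k

theorem C7C3.act_mul (g h : C7C3) (k : ZMod 7) :
    C7C3.act (g * h) k = C7C3.act g (C7C3.act h k) := by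
  have e : ∀ a b : ZMod 3, (2 : ZMod 7) ^ (a + b).val = 2 ^ a.val * 2 ^ b.val := by decide
  have h1 : (g * h).left.toAdd = g.left.toAdd + 2 ^ g.right.toAdd.val * h.left.toAdd := rfl
  have h2 : (g * h).right.toAdd = g.right.toAdd + h.right.toAdd := rfl
  rw [C7C3.act, C7C3.act, C7C3.act, h1, h2, e]
  ring

theorem C7C3.act_injective : Function.Injective C7C3.act := by
  intro g h hgh
  have h0 := congrFun hgh 0
  have h1 := congrFun hgh 1
  simp only [C7C3.act, mul_zero, add_zero, mul_one] at h0 h1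
  rw [h0] at h1
  have e : ∀ a b : ZMod 3, (2 : ZMod 7) ^ a.val = 2 ^ b.val → a = b := by decide
  exact SemidirectProduct.ext h0 (e _ _ (add_left_cancel h1))

theorem C7C3.card : Nat.card C7C3 = 21 := by
  rw [SemidirectProduct.card]
  simp

instance isGalois_splittingField {k : Type*} [Field k] [CharZero k] (p : k[X]) :
    IsGalois k p.SplittingField where
  to_isSeparable := inferInstance
  to_normal := Normal.of_isSplittingField p

/-- A septic without roots whose splitting field has degree dividing `21` is irreducible. -/
theorem irreducible_of_finrank_splittingField_dvd {k : Type*} [Field k] {f : k[X]}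
    (hdeg : f.natDegree = 7) (hdvd : Module.finrank k f.SplittingField ∣ 21)
    (hroot : ∀ x, f.eval x ≠ 0) : Irreducible f := by
  have hf0 : f ≠ 0 := by
    rintro rfl
    simp at hdeg
  have key : ∀ p : k[X], Irreducible p → p ∣ f → p.natDegree = 3 ∨ p.natDegree = 7 := by
    intro p hp hpf
    have hs : (p.map (algebraMap k f.SplittingField)).Splits :=
      (SplittingField.splits f).of_dvd (Polynomial.map_ne_zero hf0) (Polynomial.map_dvd _ hpf)
    obtain ⟨r, hr⟩ := hs.exists_eval_eq_zero (by
      rw [degree_map]; exact (degree_pos_of_irreducible hp).ne')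
    rw [eval_map_algebraMap] at hr
    have hmin : p.natDegree = (minpoly k r).natDegree := by
      rw [← minpoly.eq_of_irreducible hp hr, natDegree_mul_C]
      simpa using hp.ne_zero
    have h1 : p.natDegree ∣ 21 := by
      rw [hmin]
      exact (minpoly.degree_dvd (Algebra.IsIntegral.isIntegral r)).trans hdvd
    have h2 : p.natDegree ≠ 1 := by
      intro h
      obtain ⟨t, ht⟩ := exists_root_of_degree_eq_one
        ((degree_eq_iff_natDegree_eq_of_pos one_pos).2 h)
      exact hroot t (eval_eq_zero_of_dvd_of_eval_eq_zero hpf ht)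
    have h3 : p.natDegree ≤ 7 := hdeg ▸ natDegree_le_of_dvd hpf hf0
    interval_cases h : p.natDegree <;> revert h1 h2 <;> decide
  have hfu : ¬ IsUnit f := fun h => by
    rw [natDegree_eq_zero_of_isUnit h] at hdeg
    omega
  obtain ⟨p, hp, q, hq⟩ := WfDvdMonoid.exists_irreducible_factor hfu hf0
  have hp0 := hp.ne_zero
  have hq0 : q ≠ 0 := right_ne_zero_of_mul (hq ▸ hf0)
  have hsum : p.natDegree + q.natDegree = 7 := by rw [← natDegree_mul hp0 hq0, ← hq, hdeg]
  -- A cubic factor leaves a quartic, whose irreducible factors could only be cubic; the remaining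
  -- linear factor would give a root.
  rcases key p hp ⟨q, hq⟩ with h3 | h7
  · exfalso
    have hqu : ¬ IsUnit q := fun h => by
      have := natDegree_eq_zero_of_isUnit h
      omega
    obtain ⟨p', hp', q', hq'⟩ := WfDvdMonoid.exists_irreducible_factor hqu hq0
    have hq'0 : q' ≠ 0 := right_ne_zero_of_mul (hq' ▸ hq0)
    have hsum' : p'.natDegree + q'.natDegree = q.natDegree := by
      rw [← natDegree_mul hp'.ne_zero hq'0, ← hq']
    have h3' : p'.natDegree = 3 := by
      rcases key p' hp' (Dvd.intro_left (p * q') (by rw [hq, hq']; ring)) with h | h <;> omega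
    obtain ⟨t, ht⟩ := exists_root_of_degree_eq_one
      ((degree_eq_iff_natDegree_eq_of_pos one_pos).2 (by omega : q'.natDegree = 1))
    exact hroot t (eval_eq_zero_of_dvd_of_eval_eq_zero
      (Dvd.intro_left (p * p') (by rw [hq, hq']; ring)) ht)
  · have hqu : IsUnit q := by
      rw [Polynomial.isUnit_iff_degree_eq_zero, degree_eq_natDegree hq0]
      simp only [Nat.cast_eq_zero]
      omega
    rw [hq]
    exact (irreducible_mul_isUnit hqu).2 hp

/-! ### The Galois group over a field of characteristic zero -/

section

variable {k : Type*} [Field k] [CharZero k] {u v : k}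

/-- The roots of the septic in a splitting field, as an injective family indexed by `ℤ/7`
on which the Galois group acts by affine maps. -/
theorem exists_roots_splittingField (hu : u ≠ 0) (hv : v ≠ 0) (hS : u ^ 2 + 7 * v ^ 2 ≠ 0) :
    (∃ x : ZMod 7 → (chebyshevSeptic u v).SplittingField, Function.Injective x ∧
      (∀ i, x i ∈ (chebyshevSeptic u v).rootSet (chebyshevSeptic u v).SplittingField) ∧
      ∀ σ : (chebyshevSeptic u v).Gal, ∃ g : C7C3, ∀ i, σ (x i) = x (C7C3.act g i)) ∧
    ∃ c : (chebyshevSeptic u v).SplittingField, c ^ 3 + c ^ 2 - 2 * c - 1 = 0 := by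
  set f := chebyshevSeptic u v with hf
  let E := f.SplittingField
  let Ω := AlgebraicClosure E
  have : Algebra.IsAlgebraic k Ω := Algebra.IsAlgebraic.trans k E Ω
  have : CharZero Ω := charZero_of_injective_algebraMap (algebraMap k Ω).injective
  have : Normal k Ω := (IsAlgClosure.mk (R := k) (K := Ω) inferInstance inferInstance).normal
  obtain ⟨ψ, hψ⟩ := exists_injective_addChar_seven Ω
  set u' := algebraMap k Ω u with hu'
  set v' := algebraMap k Ω v with hv'
  set w := gaussSumSeven ψ with hw
  have hw2 : w ^ 2 = -7 := gaussSumSeven_sq hψ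
  have hw0 : w ≠ 0 := by rintro h; norm_num [h] at hw2
  have hu0 : u' ≠ 0 := (_root_.map_ne_zero _).2 hu
  have hv0 : v' ≠ 0 := (_root_.map_ne_zero _).2 hv
  have hS' : u' ^ 2 + 7 * v' ^ 2 = (u' + w * v') * (u' - w * v') := by
    linear_combination v' ^ 2 * hw2
  have hS0 : u' ^ 2 + 7 * v' ^ 2 ≠ 0 := by
    have := (_root_.map_ne_zero (algebraMap k Ω)).2 hS
    rwa [map_add, map_mul, map_pow, map_pow, map_ofNat] at this
  -- The exponents 4 and 3 add up to 7, which allows `z ^ 7` to be the conjugate expression, and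
  -- they make `y ^ 7 + z ^ 7` equal to `S ^ 3 * (α + α')`.
  obtain ⟨y, hy⟩ := IsAlgClosed.exists_pow_nat_eq
    ((u' + w * v') ^ 4 * (u' - w * v') ^ 3) (n := 7) (by norm_num)
  have hα : u' + w * v' ≠ 0 := left_ne_zero_of_mul (hS' ▸ hS0)
  have hα' : u' - w * v' ≠ 0 := right_ne_zero_of_mul (hS' ▸ hS0)
  have hy0 : y ≠ 0 := by
    rintro rfl
    rw [zero_pow (by norm_num)] at hy
    exact mul_ne_zero (pow_ne_zero _ hα) (pow_ne_zero _ hα') hy.symm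
  obtain ⟨z, hyz⟩ : ∃ z, y * z = u' ^ 2 + 7 * v' ^ 2 := ⟨_, mul_div_cancel₀ _ hy0⟩
  have hz : z ^ 7 = (u' + w * v') ^ 3 * (u' - w * v') ^ 4 := by
    refine mul_left_cancel₀ (pow_ne_zero 7 hy0) ?_
    rw [← mul_pow, hyz, hy, hS']
    ring
  have hne : y ^ 7 ≠ z ^ 7 := by
    intro h
    rw [hy, hz] at h
    have : (u' + w * v') ^ 3 * (u' - w * v') ^ 3 * (2 * (w * v')) = 0 := by
      linear_combination h
    simp [hα, hα', hw0, hv0] at this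
  have hsum : y ^ 7 + z ^ 7 = 2 * u' * (u' ^ 2 + 7 * v' ^ 2) ^ 3 := by
    rw [hy, hz, hS']
    ring
  have hroot : ∀ i, (chebyshevSeptic u' v').eval (septicRoot ψ y z i) = 0 :=
    eval_septicRoot hyz hsum
  have hlift : ∀ i, ∃ x ∈ f.rootSet E, algebraMap E Ω x = septicRoot ψ y z i := by
    intro i
    have := (SplittingField.splits f).image_rootSet_algebraMap (B := Ω)
    have hi : septicRoot ψ y z i ∈ f.rootSet Ω := by
      rw [mem_rootSet]
      exact ⟨chebyshevSeptic_ne_zero u v, (aeval_chebyshevSeptic u v _).trans (hroot i)⟩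
    rw [← this] at hi
    exact hi
  choose x hx hxe using hlift
  have hinj := septicRoot_injective hψ hne
  refine ⟨⟨x, fun i j hij => hinj ?_, hx, fun σ => ?_⟩, ?_⟩
  · rw [← hxe, ← hxe, hij]
  · let τ : Ω ≃ₐ[k] Ω := AlgEquiv.liftNormal (F := k) (K₁ := E) (K₂ := E) σ Ω
    obtain ⟨i, j, hij⟩ := exists_map_septicRoot hψ hyz hS0 hy hz (τ : Ω →+* Ω)
      (τ.commutes u) (τ.commutes v)
    refine ⟨⟨Multiplicative.ofAdd j, Multiplicative.ofAdd i⟩, fun l => ?_⟩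
    apply (algebraMap E Ω).injective
    rw [hxe]
    refine Eq.trans ?_ (hij l)
    rw [← hxe]
    exact (AlgEquiv.liftNormal_commutes (F := k) (K₁ := E) (K₂ := E) σ Ω (x l)).symm
  · have h0 : septicRoot ψ y z 0 ≠ 0 := by
      intro h
      have := hroot 0
      rw [h, eval_chebyshevSeptic] at this
      simp [hu0, hS0] at this
    -- This ratio equals `ζ + ζ⁻¹`, which therefore lies in the splitting field even if `ζ` does
    -- not.
    refine ⟨(x 1 + x (-1)) / x 0, (algebraMap E Ω).injective ?_⟩
    have : algebraMap E Ω ((x 1 + x (-1)) / x 0) = ψ 1 + ψ (-1) := by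
      rw [map_div₀, map_add, hxe, hxe, hxe, div_eq_iff h0]
      simp only [septicRoot, neg_neg, neg_zero, ψ.map_zero_eq_one]
      ring
    rw [map_zero, map_sub, map_sub, map_add, map_mul, map_pow, map_pow, map_one, map_ofNat, this]
    exact addChar_real_root hψ

/-- The Galois group of the septic embeds in `C₇ ⋊ C₃`. -/
theorem exists_gal_hom_injective (hu : u ≠ 0) (hv : v ≠ 0) (hS : u ^ 2 + 7 * v ^ 2 ≠ 0) :
    ∃ φ : (chebyshevSeptic u v).Gal →* C7C3, Function.Injective φ := by
  obtain ⟨⟨x, hinj, hx, hσ⟩, -⟩ := exists_roots_splittingField hu hv hS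
  choose g hg using hσ
  refine ⟨MonoidHom.mk' g fun σ τ => C7C3.act_injective (funext fun i => hinj ?_),
    fun σ τ h => ?_⟩
  · rw [C7C3.act_mul, ← hg, ← hg, ← hg]
    rfl
  · have hsub : Set.range x =
        -- Seven distinct roots exhaust the root set, so an automorphism is determined by its affine
        -- map.
        (chebyshevSeptic u v).rootSet (chebyshevSeptic u v).SplittingField := by
      refine Set.eq_of_subset_of_ncard_le (Set.range_subset_iff.2 hx) ?_
        (rootSet_finite _ _)
      have h1 := ncard_rootSet_le (chebyshevSeptic u v) (chebyshevSeptic u v).SplittingField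
      rw [natDegree_chebyshevSeptic] at h1
      rw [← Set.image_univ, Set.ncard_image_of_injective _ hinj, Set.ncard_univ]
      simpa using h1
    refine Gal.ext _ fun r hr => ?_
    rw [← hsub] at hr
    obtain ⟨i, rfl⟩ := hr
    rw [hg, hg]
    exact congrArg (fun g => x (C7C3.act g i)) h

theorem finrank_splittingField_dvd (hu : u ≠ 0) (hv : v ≠ 0) (hS : u ^ 2 + 7 * v ^ 2 ≠ 0) :
    Module.finrank k (chebyshevSeptic u v).SplittingField ∣ 21 := by
  obtain ⟨φ, hφ⟩ := exists_gal_hom_injective hu hv hS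
  rw [← IsGalois.card_aut_eq_finrank, ← C7C3.card]
  exact Subgroup.card_dvd_of_injective φ hφ

theorem irreducible_chebyshevSeptic (hu : u ≠ 0) (hv : v ≠ 0) (hS : u ^ 2 + 7 * v ^ 2 ≠ 0)
    (hroot : ∀ x, (chebyshevSeptic u v).eval x ≠ 0) : Irreducible (chebyshevSeptic u v) :=
  irreducible_of_finrank_splittingField_dvd (natDegree_chebyshevSeptic u v)
    (finrank_splittingField_dvd hu hv hS) hroot

theorem nonempty_gal_mulEquiv (hu : u ≠ 0) (hv : v ≠ 0) (hS : u ^ 2 + 7 * v ^ 2 ≠ 0)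
    (hirr : Irreducible (chebyshevSeptic u v))
    (hcubic : Irreducible (X ^ 3 + X ^ 2 - 2 * X - 1 : k[X])) :
    Nonempty ((chebyshevSeptic u v).Gal ≃* C7C3) := by
  obtain ⟨φ, hφ⟩ := exists_gal_hom_injective hu hv hS
  have h7 : 7 ∣ Nat.card (chebyshevSeptic u v).Gal := by
    rw [← natDegree_chebyshevSeptic u v]
    exact Gal.prime_degree_dvd_card hirr (by rw [natDegree_chebyshevSeptic]; norm_num)
  have h3 : 3 ∣ Nat.card (chebyshevSeptic u v).Gal := by
    obtain ⟨-, c, hc⟩ := exists_roots_splittingField hu hv hS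
    have hd : (X ^ 3 + X ^ 2 - 2 * X - 1 : k[X]).natDegree = 3 := by compute_degree!
    have hm : (minpoly k c).natDegree = 3 := by
      have hc' : aeval c (X ^ 3 + X ^ 2 - 2 * X - 1 : k[X]) = 0 := by
        simpa [map_ofNat] using hc
      rw [← minpoly.eq_of_irreducible hcubic hc', natDegree_mul_C, hd]
      simpa using hcubic.ne_zero
    rw [← hm, Gal.card_of_separable hirr.separable]
    exact minpoly.degree_dvd (Algebra.IsIntegral.isIntegral c)
  have h21 : Nat.card (chebyshevSeptic u v).Gal = Nat.card C7C3 := by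
    have h := Subgroup.card_dvd_of_injective φ hφ
    rw [C7C3.card] at h ⊢
    exact Nat.dvd_antisymm h (Nat.Coprime.mul_dvd_of_dvd_of_dvd (by norm_num) h3 h7)
  have : Finite C7C3 := Nat.finite_of_card_ne_zero (by rw [C7C3.card]; norm_num)
  exact ⟨MulEquiv.ofBijective φ ((Nat.bijective_iff_injective_and_card φ).2 ⟨hφ, h21⟩)⟩

end

/-! ### Chebyshev identities in any ring and a local obstruction to roots -/

theorem two_mul_eval_chebyshevSeptic {R : Type*} [CommRing R] {u v x y z : R} (hx : 2 * x = y + z)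
    (h : y * z = u ^ 2 + 7 * v ^ 2) :
    2 * (chebyshevSeptic u v).eval x = y ^ 7 + z ^ 7 - 2 * u * (u ^ 2 + 7 * v ^ 2) ^ 3 := by
  have e : 2 * (chebyshevSeptic u v).eval x = (2 * x) ^ 7 - 7 * (y * z) * (2 * x) ^ 5 +
      14 * (y * z) ^ 2 * (2 * x) ^ 3 - 7 * (y * z) ^ 3 * (2 * x) - 2 * u * (y * z) ^ 3 := by
    rw [eval_chebyshevSeptic, h]
    ring
  rw [e, hx, ← h]
  ring

/-- This is the derivative of the identity `2 G = y ^ 7 + z ^ 7 - const` along the curve `y z = S`.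
It shows that a root is simple when `7 * (y ^ 7 - z ^ 7)` is nonzero. -/
theorem eval_derivative_chebyshevSeptic {R : Type*} [CommRing R] {u v x y z : R}
    (hx : 2 * x = y + z) (h : y * z = u ^ 2 + 7 * v ^ 2) :
    (derivative (chebyshevSeptic u v)).eval x * (y - z) = 7 * (y ^ 7 - z ^ 7) := by
  have e : (derivative (chebyshevSeptic u v)).eval x =
      7 * ((2 * x) ^ 6 - 5 * (y * z) * (2 * x) ^ 4 + 6 * (y * z) ^ 2 * (2 * x) ^ 2 -
        (y * z) ^ 3) := by
    rw [chebyshevSeptic_eq, h]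
    simp only [derivative_add, derivative_sub, derivative_C_mul, derivative_X_pow, derivative_X,
      derivative_C, eval_add, eval_sub, eval_mul, eval_pow, eval_X, eval_C, eval_one,
      eval_zero]
    push_cast
    ring
  rw [e, hx]
  ring

/-- If a prime exactly divides `u² + 7v²` and is prime to `2u`, then the septic has no root in the
fraction field. -/
theorem eval_chebyshevSeptic_ne_zero_of_exactly_dvd {R K : Type*} [CommRing R] [IsDomain R]
    [IsIntegrallyClosed R] [Field K] [Algebra R K] [IsFractionRing R K] {p u v m : R}
    (hp : Prime p) (h2 : ¬ p ∣ 2) (hu : ¬ p ∣ u) (hm : ¬ p ∣ m) (h : u ^ 2 + 7 * v ^ 2 = p * m)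
    (x : K) : (chebyshevSeptic (algebraMap R K u) (algebraMap R K v)).eval x ≠ 0 := by
  intro hx
  -- Twice the septic, rewritten in the variable `2 x`, is monic, so `2 x` is integral over `R`.
  let g : R[X] := X ^ 7 - C (7 * (p * m)) * X ^ 5 + C (14 * (p * m) ^ 2) * X ^ 3 -
    C (7 * (p * m) ^ 3) * X - C (2 * u * (p * m) ^ 3)
  have hg : g.Monic := by
    simp only [g]
    monicity!
  have hSK : algebraMap R K u ^ 2 + 7 * algebraMap R K v ^ 2 = algebraMap R K (p * m) := by
    rw [← h]
    simp only [map_add, map_mul, map_pow, map_ofNat]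
  have h2x : aeval (2 * x) g = 0 := by
    rw [eval_chebyshevSeptic, hSK] at hx
    simp only [g, map_sub, map_add, map_mul, map_pow, aeval_X, aeval_C, map_ofNat] at hx ⊢
    linear_combination 2 * hx
  obtain ⟨z, hz⟩ := IsIntegrallyClosed.isIntegral_iff.1 (⟨g, hg, h2x⟩ : IsIntegral R (2 * x))
  rw [← hz, aeval_algebraMap_apply, FaithfulSMul.algebraMap_eq_zero_iff] at h2x
  simp only [g, map_sub, map_add, map_mul, map_pow, aeval_X, aeval_C, map_ofNat,
    Algebra.algebraMap_self, RingHom.id_apply] at h2x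
  obtain ⟨t, rfl⟩ : p ∣ z := hp.dvd_of_dvd_pow (n := 7)
    ⟨7 * m * z ^ 5 - 14 * p * m ^ 2 * z ^ 3 + 7 * p ^ 2 * m ^ 3 * z + 2 * u * p ^ 2 * m ^ 3, by
      linear_combination h2x⟩
  -- With `z = p t`, every term except the constant one is divisible by `p ^ 4`, whereas the
  -- constant term carries only `p ^ 3`.
  have hdvd : p ∣ 2 * u * m ^ 3 :=
    ⟨p ^ 3 * t ^ 7 - 7 * p ^ 2 * m * t ^ 5 + 14 * p * m ^ 2 * t ^ 3 - 7 * m ^ 3 * t, by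
      refine mul_left_cancel₀ (pow_ne_zero 3 hp.ne_zero) ?_
      linear_combination -h2x⟩
  rcases hp.dvd_or_dvd hdvd with h' | h'
  · exact (hp.dvd_or_dvd h').elim h2 hu
  · exact hm (hp.dvd_of_dvd_pow h')

/-! ### Irreducibility of the cubic and of the generic septic -/

theorem map_cubic {A B : Type*} [CommRing A] [CommRing B] (θ : A →+* B) :
    (X ^ 3 + X ^ 2 - 2 * X - 1 : A[X]).map θ = X ^ 3 + X ^ 2 - 2 * X - 1 := by
  simp only [Polynomial.map_sub, Polynomial.map_add, Polynomial.map_mul, Polynomial.map_pow,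
    map_X, Polynomial.map_one, Polynomial.map_ofNat]

/-- A factorization of the monic cubic over `R` would survive any specialisation `φ`, and Gauss's
lemma passes from `R` to `K`. -/
theorem irreducible_cubic_fractionField {R K k : Type*} [CommRing R] [IsDomain R]
    [IsIntegrallyClosed R] [Field K] [Algebra R K] [IsFractionRing R K] [Field k] (φ : R →+* k)
    (h : Irreducible (X ^ 3 + X ^ 2 - 2 * X - 1 : k[X])) :
    Irreducible (X ^ 3 + X ^ 2 - 2 * X - 1 : K[X]) := by
  have hm : (X ^ 3 + X ^ 2 - 2 * X - 1 : R[X]).Monic := by monicity!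
  have := (hm.irreducible_iff_irreducible_map_fraction_map (K := K)).1
    (hm.irreducible_of_irreducible_map φ _ (by rwa [map_cubic]))
  rwa [map_cubic] at this

theorem irreducible_cubic_rat : Irreducible (X ^ 3 + X ^ 2 - 2 * X - 1 : ℚ[X]) := by
  refine irreducible_cubic_fractionField (Int.castRingHom (ZMod 2)) ?_
  have hd : (X ^ 3 + X ^ 2 - 2 * X - 1 : (ZMod 2)[X]).natDegree = 3 := by compute_degree!
  refine irreducible_of_degree_le_three_of_not_isRoot (by simp [hd]) fun x => ?_
  simp only [IsRoot, eval_sub, eval_add, eval_mul, eval_pow, eval_X, eval_one, eval_ofNat]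
  revert x
  decide

theorem irreducible_cubic_ratFunUV : Irreducible (X ^ 3 + X ^ 2 - 2 * X - 1 : RatFunUV[X]) :=
  irreducible_cubic_fractionField (R := MvPolynomial (Fin 2) ℚ) (MvPolynomial.eval ![2, 1])
    irreducible_cubic_rat

/-- Here `S = 11` is itself prime, so the local obstruction applies with `m = 1`. This one
specialisation suffices for the generic septic. -/
theorem irreducible_chebyshevSeptic_two_one : Irreducible (chebyshevSeptic (2 : ℚ) 1) := by
  refine irreducible_chebyshevSeptic (by norm_num) (by norm_num) (by norm_num) fun x => ?_
  have := eval_chebyshevSeptic_ne_zero_of_exactly_dvd (R := ℤ) (p := 11) (u := 2) (v := 1)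
    (m := 1) (Int.prime_iff_natAbs_prime.2 (by norm_num)) (by norm_num) (by norm_num)
    (by norm_num) (by norm_num) x
  simpa using this

/-- The septic over `ℚ[u, v]`, made monic. -/
noncomputable def genericSeptic : (MvPolynomial (Fin 2) ℚ)[X] :=
  C (MvPolynomial.C (64⁻¹ : ℚ)) * chebyshevSeptic (MvPolynomial.X 0) (MvPolynomial.X 1)

theorem genericSeptic_monic : genericSeptic.Monic := by
  have h64 : (MvPolynomial.C (64⁻¹ : ℚ) : MvPolynomial (Fin 2) ℚ) * 64 = 1 := by
    rw [← map_ofNat (MvPolynomial.C (σ := Fin 2) (R := ℚ)) 64, ← map_mul]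
    norm_num
  refine monic_of_natDegree_le_of_coeff_eq_one 7 ?_ ?_
  · refine (natDegree_C_mul_le _ _).trans ?_
    rw [chebyshevSeptic_eq]
    compute_degree!
  · rw [genericSeptic, coeff_C_mul, chebyshevSeptic_eq]
    simp only [coeff_sub, coeff_add, coeff_C_mul, coeff_X_pow, coeff_X, coeff_C]
    simpa using h64

theorem irreducible_genericSeptic : Irreducible genericSeptic := by
  refine genericSeptic_monic.irreducible_of_irreducible_map (MvPolynomial.eval ![2, 1]) _ ?_
  rw [genericSeptic, Polynomial.map_mul, map_chebyshevSeptic, map_C, MvPolynomial.eval_C]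
  refine (irreducible_isUnit_mul (isUnit_C.2 (IsUnit.mk0 _ (by norm_num)))).2 ?_
  simpa using irreducible_chebyshevSeptic_two_one

theorem irreducible_chebyshevSeptic_generic : Irreducible (chebyshevSeptic varU varV) := by
  have h := (genericSeptic_monic.irreducible_iff_irreducible_map_fraction_map
    (K := RatFunUV)).1 irreducible_genericSeptic
  rw [genericSeptic, Polynomial.map_mul, map_chebyshevSeptic, map_C] at h
  refine (irreducible_isUnit_mul (isUnit_C.2 (IsUnit.mk0 _ ?_))).1 h
  rw [Ne, FaithfulSMul.algebraMap_eq_zero_iff, MvPolynomial.C_eq_zero]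
  norm_num

theorem nonempty_gal_generic_mulEquiv : Nonempty ((chebyshevSeptic varU varV).Gal ≃* C7C3) := by
  have key : ∀ q : MvPolynomial (Fin 2) ℚ, MvPolynomial.eval ![1, 1] q ≠ 0 →
      algebraMap (MvPolynomial (Fin 2) ℚ) RatFunUV q ≠ 0 := fun q hq h => hq (by
    rw [FaithfulSMul.algebraMap_eq_zero_iff] at h
    rw [h, map_zero])
  have hS := key (MvPolynomial.X 0 ^ 2 + 7 * MvPolynomial.X 1 ^ 2) (by simp; norm_num)
  rw [map_add, map_mul, map_pow, map_pow, map_ofNat] at hS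
  exact nonempty_gal_mulEquiv (key _ (by simp)) (key _ (by simp)) hS
    irreducible_chebyshevSeptic_generic irreducible_cubic_ratFunUV

/-! ### The thin exceptional set -/

/-- The parameters for which the septic acquires a rational root. -/
def septicRootSet : Set (Fin 2 → ℚ) := {t | ∃ x, (chebyshevSeptic (t 0) (t 1)).eval x = 0}

/-- The covering variety is the hypersurface cut out by the septic: it is integral because the
generic septic is irreducible, of degree 7 over the plane, and its rational points are parameters
together with a rational root. -/
theorem isThinTypeTwo_septicRootSet : IsThinTypeTwo septicRootSet := by
  have hdom : IsDomain (AdjoinRoot genericSeptic) :=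
    AdjoinRoot.isDomain_of_prime irreducible_genericSeptic.prime
  have hdeg : genericSeptic.natDegree = 7 := by
    rw [← genericSeptic_monic.natDegree_map (MvPolynomial.eval ![2, 1]), genericSeptic,
      Polynomial.map_mul, map_C, map_chebyshevSeptic, MvPolynomial.eval_C,
      natDegree_C_mul (by norm_num), natDegree_chebyshevSeptic]
  have hinj : Function.Injective
      (algebraMap (MvPolynomial (Fin 2) ℚ) (AdjoinRoot genericSeptic)) :=
    AdjoinRoot.of.injective_of_degree_ne_zero
      (degree_ne_of_natDegree_ne (n := 0) (by rw [hdeg]; norm_num))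
  have : Module.Finite (MvPolynomial (Fin 2) ℚ) (AdjoinRoot genericSeptic) :=
    genericSeptic_monic.finite_adjoinRoot
  refine ⟨AdjoinRoot genericSeptic, inferInstance, hdom, inferInstance,
    IsScalarTower.toAlgHom ℚ (MvPolynomial (Fin 2) ℚ) (AdjoinRoot genericSeptic), hinj,
    Algebra.FiniteType.trans (S := MvPolynomial (Fin 2) ℚ) inferInstance inferInstance, ?_, ?_⟩
  · let alg : Algebra (FractionRing (MvPolynomial (Fin 2) ℚ))
        (FractionRing (AdjoinRoot genericSeptic)) :=
      (IsFractionRing.map (K := FractionRing (MvPolynomial (Fin 2) ℚ))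
        (L := FractionRing (AdjoinRoot genericSeptic))
        (j := (IsScalarTower.toAlgHom ℚ (MvPolynomial (Fin 2) ℚ)
          (AdjoinRoot genericSeptic)).toRingHom) hinj).toAlgebra
    change 2 ≤ @Module.finrank _ _ _ _ alg.toModule
    have : IsScalarTower (MvPolynomial (Fin 2) ℚ) (FractionRing (MvPolynomial (Fin 2) ℚ))
        (FractionRing (AdjoinRoot genericSeptic)) := by
      refine IsScalarTower.of_algebraMap_eq fun q => ?_
      rw [IsScalarTower.algebraMap_apply (MvPolynomial (Fin 2) ℚ) (AdjoinRoot genericSeptic)]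
      exact (IsLocalization.map_eq (M := nonZeroDivisors (MvPolynomial (Fin 2) ℚ))
        (T := nonZeroDivisors (AdjoinRoot genericSeptic))
        (nonZeroDivisors_le_comap_nonZeroDivisors_of_injective _ hinj) q).symm
    rw [IsFractionRing.finrank_eq (MvPolynomial (Fin 2) ℚ) (FractionRing (MvPolynomial (Fin 2) ℚ))
      (AdjoinRoot genericSeptic) (FractionRing (AdjoinRoot genericSeptic)),
      (AdjoinRoot.powerBasis' genericSeptic_monic).finrank, AdjoinRoot.powerBasis'_dim, hdeg]
    norm_num
  · rintro t ⟨x, hx⟩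
    have h0 : eval₂ (MvPolynomial.aeval t : MvPolynomial (Fin 2) ℚ →ₐ[ℚ] ℚ) x genericSeptic = 0 := by
      rw [genericSeptic, eval₂_mul, eval₂_eq_eval_map _ (p := chebyshevSeptic _ _),
        map_chebyshevSeptic]
      simp [hx]
    refine ⟨AdjoinRoot.liftAlgHom _ (MvPolynomial.aeval t) x h0, fun i => ?_⟩
    refine (AdjoinRoot.lift_of (a := x) h0).trans ?_
    simp

theorem isThin_septicRootSet : IsThin septicRootSet :=
  ⟨{septicRootSet}, Set.finite_singleton _, fun _ hY => Or.inr (hY ▸ isThinTypeTwo_septicRootSet),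
    by simp⟩

theorem septic_parameters_ne_zero {r s : ℤ} (h : ¬ 7 ∣ r * s) :
    (r : ℚ) ≠ 0 ∧ (s : ℚ) ≠ 0 ∧ (r : ℚ) ^ 2 + 7 * (s : ℚ) ^ 2 ≠ 0 := by
  have hr : (r : ℚ) ≠ 0 := by
    rintro h'
    simp [Int.cast_eq_zero.1 h'] at h
  have hs : (s : ℚ) ≠ 0 := by
    rintro h'
    simp [Int.cast_eq_zero.1 h'] at h
  exact ⟨hr, hs, by positivity⟩

theorem specialization_of_no_root {r s : ℤ} (h : ¬ 7 ∣ r * s)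
    (hroot : ∀ x, (chebyshevSeptic (r : ℚ) (s : ℚ)).eval x ≠ 0) :
    Irreducible (chebyshevSeptic (r : ℚ) (s : ℚ)) ∧
      Nonempty ((chebyshevSeptic (r : ℚ) (s : ℚ)).Gal ≃* C7C3) := by
  obtain ⟨hr, hs, hS⟩ := septic_parameters_ne_zero h
  have hirr := irreducible_chebyshevSeptic hr hs hS hroot
  exact ⟨hirr, nonempty_gal_mulEquiv hr hs hS hirr irreducible_cubic_rat⟩

/-! ### Roots in `ℚ_p` and choice of parameters -/

theorem isSquare_neg_seven {p : ℕ} [Fact p.Prime] (h4 : p % 4 = 1) (h7 : p % 7 = 2) :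
    IsSquare (-7 : ZMod p) := by
  have : Fact (Nat.Prime 7) := ⟨by norm_num⟩
  have h1 : IsSquare (-1 : ZMod p) := ZMod.exists_sq_eq_neg_one_iff.2 (by omega)
  have h2 : IsSquare ((7 : ℕ) : ZMod p) := by
    refine (ZMod.exists_sq_eq_prime_iff_of_mod_four_eq_one h4 (by norm_num)).2 ⟨3, ?_⟩
    have : ((p : ℕ) : ZMod 7) = ((2 : ℕ) : ZMod 7) := (ZMod.natCast_eq_natCast_iff' _ _ _).2 h7
    rw [this]
    rfl
  have := h1.mul h2
  rwa [Nat.cast_ofNat, neg_one_mul] at this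

theorem exists_pow_seven_eq {p : ℕ} [Fact p.Prime] (h7 : p % 7 = 2) {b : ZMod p} (hb : b ≠ 0) :
    ∃ y, y ^ 7 = b := by
  -- Since `p - 1 = 7 * (p / 7) + 1`, Fermat's little theorem makes `b ^ (7 * (p / 7))` the inverse
  -- of `b`.
  refine ⟨b⁻¹ ^ (p / 7), ?_⟩
  have h := ZMod.pow_card_sub_one_eq_one hb
  rw [show p - 1 = p / 7 * 7 + 1 by omega, pow_succ] at h
  rw [← pow_mul, inv_pow, inv_eq_iff_eq_inv]
  exact eq_inv_of_mul_eq_one_left h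

/-- If `p ≡ 1 (mod 4)` and `p ≡ 2 (mod 7)`, then the septic with parameters `(r, 1)` has a simple
root modulo `p`, hence a root in `ℚ_p`. -/
theorem exists_padic_root {p : ℕ} [Fact p.Prime] (h4 : p % 4 = 1) (h7 : p % 7 = 2) {r : ℤ}
    (hr : ¬ (p : ℤ) ∣ r ^ 2 + 7) :
    ∃ x : ℚ_[p], (chebyshevSeptic (r : ℚ_[p]) 1).eval x = 0 := by
  obtain ⟨w, hw⟩ := isSquare_neg_seven h4 h7
  have h2 : (2 : ZMod p) ≠ 0 := by
    have : ((2 : ℕ) : ZMod p) ≠ 0 := by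
      rw [Ne, ZMod.natCast_eq_zero_iff]
      intro h
      have := Nat.le_of_dvd (by norm_num) h
      have := (Fact.out : p.Prime).two_le
      omega
    exact_mod_cast this
  have hseven : (7 : ZMod p) ≠ 0 := by
    have : ((7 : ℕ) : ZMod p) ≠ 0 := by
      rw [Ne, ZMod.natCast_eq_zero_iff, Nat.dvd_prime (by norm_num)]
      rintro (h | h) <;> omega
    exact_mod_cast this
  have hw0 : w ≠ 0 := by
    rintro rfl
    exact hseven (by linear_combination -hw)
  set u : ZMod p := (r : ZMod p) with hu
  have hS0 : u ^ 2 + 7 * 1 ^ 2 ≠ 0 := by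
    rw [hu]
    intro h
    apply hr
    rw [← ZMod.intCast_zmod_eq_zero_iff_dvd]
    push_cast
    linear_combination h
  have hS : u ^ 2 + 7 * 1 ^ 2 = (u + w) * (u - w) := by linear_combination -hw
  have hα : u + w ≠ 0 := left_ne_zero_of_mul (hS ▸ hS0)
  have hα' : u - w ≠ 0 := right_ne_zero_of_mul (hS ▸ hS0)
  have hβ : (u + w) ^ 4 * (u - w) ^ 3 ≠ 0 := mul_ne_zero (pow_ne_zero _ hα) (pow_ne_zero _ hα')
  obtain ⟨y, hy⟩ := exists_pow_seven_eq h7 hβ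
  have hy0 : y ≠ 0 := by
    rintro rfl
    rw [zero_pow (by norm_num)] at hy
    exact hβ hy.symm
  obtain ⟨z, hyz⟩ : ∃ z, y * z = u ^ 2 + 7 * 1 ^ 2 := ⟨_, mul_div_cancel₀ _ hy0⟩
  have hz : z ^ 7 = (u + w) ^ 3 * (u - w) ^ 4 := by
    refine mul_left_cancel₀ (pow_ne_zero 7 hy0) ?_
    rw [← mul_pow, hyz, hy, hS]
    ring
  obtain ⟨x, hx⟩ : ∃ x, 2 * x = y + z := ⟨_, mul_div_cancel₀ _ h2⟩
  have hx0 : (chebyshevSeptic u 1).eval x = 0 := by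
    refine (mul_eq_zero.1 ?_).resolve_left h2
    rw [two_mul_eval_chebyshevSeptic hx hyz, hy, hz, hS]
    ring
  have hx1 : (derivative (chebyshevSeptic u 1)).eval x ≠ 0 := by
    intro h
    have h' := eval_derivative_chebyshevSeptic hx hyz
    rw [h, hy, hz, zero_mul] at h'
    have : 7 * ((u + w) ^ 3 * (u - w) ^ 3 * (2 * w)) = 0 := by linear_combination -h'
    simp [hseven, hα, hα', h2, hw0] at this
  obtain ⟨a, rfl⟩ := ZMod.intCast_surjective x
  have hcast : ∀ q : ℤ[X], ((q.eval a : ℤ) : ZMod p) = (q.map (Int.castRingHom (ZMod p))).eval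
      (a : ZMod p) := fun q => by
    rw [← eq_intCast (Int.castRingHom (ZMod p)) a, eval_map_apply, eq_intCast]
  have hnorm : ∀ q : ℤ[X], aeval (a : ℤ_[p]) q = ((q.eval a : ℤ) : ℤ_[p]) := fun q => by
    rw [← eq_intCast (algebraMap ℤ ℤ_[p]) a, aeval_algebraMap_apply, eq_intCast, coe_aeval_eq_eval]
  have hmap : (chebyshevSeptic r 1).map (Int.castRingHom (ZMod p)) = chebyshevSeptic u 1 := by
    rw [map_chebyshevSeptic, map_one, eq_intCast]
  have hF : ‖aeval (a : ℤ_[p]) (chebyshevSeptic r 1)‖ < 1 := by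
    rw [hnorm, PadicInt.norm_int_lt_one_iff_dvd, ← ZMod.intCast_zmod_eq_zero_iff_dvd, hcast, hmap,
      hx0]
  have hF' : ‖aeval (a : ℤ_[p]) (derivative (chebyshevSeptic r 1))‖ = 1 := by
    refine le_antisymm (PadicInt.norm_le_one _) (not_lt.1 fun h => hx1 ?_)
    rwa [hnorm, PadicInt.norm_int_lt_one_iff_dvd, ← ZMod.intCast_zmod_eq_zero_iff_dvd, hcast,
      ← derivative_map, hmap] at h
  obtain ⟨ξ, hξ, -⟩ := hensels_lemma (F := chebyshevSeptic r 1) (a := (a : ℤ_[p]))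
    (by rw [hF', one_pow]; exact hF)
  refine ⟨ξ, ?_⟩
  rw [aeval_chebyshevSeptic] at hξ
  have := congrArg (algebraMap ℤ_[p] ℚ_[p]) hξ
  rw [← eval_map_apply, map_chebyshevSeptic] at this
  simpa using this

/-- Parameters `r` for which the prime `p` exactly divides `r² + 7` and `7 ∤ r`. -/
theorem exists_exactly_dvd {p : ℕ} [Fact p.Prime] (h4 : p % 4 = 1) (h7 : p % 7 = 2) :
    ∃ r m : ℤ, ¬ 7 ∣ r ∧ r ^ 2 + 7 = p * m ∧ ¬ (p : ℤ) ∣ m ∧ ¬ (p : ℤ) ∣ r := by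
  have hp : Prime (p : ℤ) := Nat.prime_iff_prime_int.1 Fact.out
  have hp2 : ¬ (p : ℤ) ∣ 2 := fun h => by
    have := Int.le_of_dvd (by norm_num) h
    have := (Fact.out : p.Prime).two_le
    omega
  have hp7 : ¬ (p : ℤ) ∣ 7 := fun h => by
    have h : p ∣ 7 := by exact_mod_cast h
    rw [Nat.dvd_prime (by norm_num)] at h
    rcases h with h | h <;> omega
  obtain ⟨w, hw⟩ := isSquare_neg_seven h4 h7
  obtain ⟨a, rfl⟩ := ZMod.intCast_surjective w
  have ha : (p : ℤ) ∣ a ^ 2 + 7 := by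
    rw [← ZMod.intCast_zmod_eq_zero_iff_dvd]
    push_cast
    linear_combination -hw
  have hna : ∀ b : ℤ, (p : ℤ) ∣ b ^ 2 + 7 → ¬ (p : ℤ) ∣ b := fun b hb h =>
    hp7 ((dvd_add_right (dvd_pow h two_ne_zero)).1 hb)
  obtain ⟨b, m, hm, hpm⟩ : ∃ b m : ℤ, b ^ 2 + 7 = p * m ∧ ¬ (p : ℤ) ∣ m := by
    obtain ⟨m, hm⟩ := ha
    by_cases hpm : (p : ℤ) ∣ m
    -- Shifting by `p` changes the cofactor by `2 * a` mod `p`, which is nonzero.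
    · refine ⟨a + p, m + 2 * a + p, by linear_combination hm, fun h => ?_⟩
      have : (p : ℤ) ∣ 2 * a := by
        have := dvd_sub (dvd_sub h hpm) (dvd_refl (p : ℤ))
        rwa [show m + 2 * a + p - m - p = 2 * a by ring] at this
      exact (hp.dvd_or_dvd this).elim hp2 (hna a ⟨m, hm⟩)
    · exact ⟨a, m, hm, hpm⟩
  by_cases hb : 7 ∣ b
  -- Shifting by `p ^ 2` preserves the cofactor mod `p` and destroys divisibility by 7.
  · refine ⟨b + p ^ 2, m + 2 * b * p + p ^ 3, fun h => ?_, by linear_combination hm, fun h => ?_,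
      fun h => ?_⟩
    · have : (7 : ℤ) ∣ p ^ 2 := (dvd_add_right hb).1 h
      have := Int.Prime.dvd_pow' (by norm_num : Nat.Prime 7) this
      omega
    · refine hpm ?_
      have := dvd_sub h (Dvd.intro (2 * b + p ^ 2) rfl)
      rwa [show m + 2 * b * p + p ^ 3 - p * (2 * b + p ^ 2) = m by ring] at this
    · exact hna b ⟨m, hm⟩ ((dvd_add_left (dvd_pow_self _ two_ne_zero)).1 h)
  · exact ⟨b, m, hb, hm, hpm, hna b ⟨m, hm⟩⟩

/-! ### Fields generated by a root and their normal closures -/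

open IntermediateField in
theorem nonempty_algHom_of_root {F E E' : Type*} [Field F] [Field E] [Field E'] [Algebra F E]
    [Algebra F E'] {f : F[X]} (hf : Irreducible f) {a : E} (ha : aeval a f = 0) {b : E'}
    (hb : aeval b f = 0) : Nonempty (F⟮a⟯ →ₐ[F] E') := by
  have hint : IsIntegral F a := isAlgebraic_iff_isIntegral.1 ⟨f, hf.ne_zero, ha⟩
  refine ⟨(algHomAdjoinIntegralEquiv F hint).symm ⟨b, ?_⟩⟩
  rw [mem_aroots]
  refine ⟨minpoly.ne_zero hint, ?_⟩
  rw [← minpoly.eq_of_irreducible hf ha, map_mul, hb, zero_mul]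

open IntermediateField in
/-- The normal closure of the field generated by a root of an irreducible polynomial is a
splitting field. -/
theorem nonempty_splittingField_algEquiv_normalClosure {F Ω : Type*} [Field F] [Field Ω]
    [Algebra F Ω] [Normal F Ω] {f : F[X]} (hf : Irreducible f) {a : Ω} (ha : aeval a f = 0) :
    Nonempty (f.SplittingField ≃ₐ[F] normalClosure F F⟮a⟯ Ω) := by
  have hgen : aeval (AdjoinSimple.gen F a) f = 0 := by
    apply (algebraMap F⟮a⟯ Ω).injective
    rw [← aeval_algebraMap_apply, AdjoinSimple.algebraMap_gen, ha, map_zero]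
  have hmin := minpoly.eq_of_irreducible hf hgen
  have hlc : f.leadingCoeff⁻¹ ≠ 0 := inv_ne_zero (leadingCoeff_ne_zero.2 hf.ne_zero)
  have : Normal F f.SplittingField := Normal.of_isSplittingField f
  obtain ⟨b, hb⟩ : ∃ b : f.SplittingField, aeval b f = 0 := by
    obtain ⟨b, hb⟩ := (SplittingField.splits f).exists_eval_eq_zero (by
      rw [degree_map]; exact (degree_pos_of_irreducible hf).ne')
    exact ⟨b, by rwa [eval_map_algebraMap] at hb⟩
  obtain ⟨ι⟩ := nonempty_algHom_of_root hf ha hb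
  have h : IsNormalClosure F F⟮a⟯ f.SplittingField := by
    refine ⟨fun x => ?_, ?_⟩
    · rw [← minpoly.algHom_eq ι ι.injective x]
      exact Normal.splits inferInstance _
    · rw [eq_top_iff]
      -- The conjugates of the generator suffice: its minimal polynomial is `f` up to a scalar, and
      -- the roots of `f` generate the splitting field.
      refine le_trans ?_ (le_iSup _ (AdjoinSimple.gen F a))
      intro x _
      have hx : x ∈ Algebra.adjoin F (f.rootSet f.SplittingField) := by
        rw [SplittingField.adjoin_rootSet]
        trivial
      have hroots : f.rootSet f.SplittingField ⊆
          (minpoly F (AdjoinSimple.gen F a)).rootSet f.SplittingField := by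
        intro y hy
        rw [mem_rootSet] at hy ⊢
        refine ⟨fun h0 => ?_, ?_⟩
        · rw [h0] at hmin
          exact mul_ne_zero hf.ne_zero (C_ne_zero.2 hlc) hmin
        · rw [← hmin, map_mul, hy.2, zero_mul]
      exact algebra_adjoin_le_adjoin F _ (Algebra.adjoin_mono hroots hx)
  exact ⟨IsNormalClosure.equiv (K := F⟮a⟯)⟩

/-! ### Infinitely many non-isomorphic septic fields -/

/-- Pairs of a prime `p` and an integer `r` such that `p` exactly divides `r² + 7`, subject to the
congruence conditions which give the septic attached to other parameters a root in `ℚ_p`. -/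
def IsRamifiedPair (x : ℕ × ℤ) : Prop :=
  x.1.Prime ∧ x.1 % 4 = 1 ∧ x.1 % 7 = 2 ∧ ¬ 7 ∣ x.2 ∧
    ∃ m : ℤ, x.2 ^ 2 + 7 = x.1 * m ∧ ¬ (x.1 : ℤ) ∣ m ∧ ¬ (x.1 : ℤ) ∣ x.2

theorem exists_seq_isRamifiedPair :
    ∃ x : ℕ → ℕ × ℤ, (∀ n, IsRamifiedPair (x n)) ∧
      ∀ m n, m < n → ¬ ((x n).1 : ℤ) ∣ (x m).2 ^ 2 + 7 := by
  refine exists_seq_of_forall_finset_exists IsRamifiedPair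
    (fun x y => ¬ (y.1 : ℤ) ∣ x.2 ^ 2 + 7) fun s _ => ?_
  -- The class 9 mod 28 is 1 mod 4 and 2 mod 7. Exceeding the sum, `p` exceeds each earlier `x.2 ^ 2
  -- + 7` and cannot divide it.
  obtain ⟨p, hp, hprime, hmod⟩ := Nat.forall_exists_prime_gt_and_eq_mod (q := 28) (a := 9)
    (by decide) (∑ x ∈ s, (x.2 ^ 2 + 7).natAbs)
  have hmod' : p % 28 = 9 := (ZMod.natCast_eq_natCast_iff' p 9 28).1 hmod
  have : Fact p.Prime := ⟨hprime⟩
  have h4 : p % 4 = 1 := by omega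
  have h7 : p % 7 = 2 := by omega
  obtain ⟨r, m, hr7, hm, hpm, hpr⟩ := exists_exactly_dvd h4 h7
  refine ⟨(p, r), ⟨hprime, h4, h7, hr7, m, hm, hpm, hpr⟩, fun x hx hdvd => ?_⟩
  have h1 : (x.2 ^ 2 + 7).natAbs ≤ ∑ x ∈ s, (x.2 ^ 2 + 7).natAbs :=
    Finset.single_le_sum (f := fun x : ℕ × ℤ => (x.2 ^ 2 + 7).natAbs) (fun _ _ => Nat.zero_le _) hx
  have h2 : p ≤ (x.2 ^ 2 + 7).natAbs :=
    Nat.le_of_dvd (Int.natAbs_pos.2 (by positivity)) (Int.natCast_dvd.1 hdvd)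
  omega

/-- A general `R` serves both `ℤ`, for irreducibility over `ℚ`, and `ℤ_[p]`, for separating the
fields. -/
theorem IsRamifiedPair.eval_ne_zero {x : ℕ × ℤ} (hx : IsRamifiedPair x) {R K : Type*} [CommRing R]
    [IsDomain R] [IsIntegrallyClosed R] [Field K] [Algebra R K] [IsFractionRing R K]
    (hp : Prime (x.1 : R)) (hdvd : ∀ n : ℤ, (x.1 : R) ∣ n ↔ (x.1 : ℤ) ∣ n) (t : K) :
    (chebyshevSeptic (x.2 : K) 1).eval t ≠ 0 := by
  obtain ⟨hprime, h4, -, -, m, hm, hpm, hpr⟩ := hx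
  have h := eval_chebyshevSeptic_ne_zero_of_exactly_dvd (R := R) (K := K) (p := x.1)
    (u := (x.2 : R)) (v := 1) (m := (m : R)) hp ?_ (by rwa [hdvd]) (by rwa [hdvd])
    (by rw [one_pow, mul_one]; exact_mod_cast congrArg (Int.cast (R := R)) hm) t
  · simpa using h
  · rw [← Int.cast_two, hdvd]
    intro h
    have := Int.le_of_dvd (by norm_num) h
    have := hprime.two_le
    omega

theorem exists_septic_fields : ∃ K : ℕ → IntermediateField ℚ (AlgebraicClosure ℚ),
    (∀ i j, i ≠ j → IsEmpty (K i ≃+* K j)) ∧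
    ∀ i, Module.finrank ℚ (K i) = 7 ∧
      Nonempty ((IntermediateField.normalClosure ℚ (K i) (AlgebraicClosure ℚ) ≃ₐ[ℚ]
        IntermediateField.normalClosure ℚ (K i) (AlgebraicClosure ℚ)) ≃* C7C3) ∧
      ∃ (r s : ℤ) (a : AlgebraicClosure ℚ), IsCoprime r s ∧ ¬ (7 ∣ r * s) ∧
        aeval a (chebyshevSeptic (r : ℚ) (s : ℚ)) = 0 ∧ K i = IntermediateField.adjoin ℚ {a} := by
  have : Algebra.IsAlgebraic ℚ (AlgebraicClosure ℚ) := by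
    -- Two `ℚ`-algebra structures on the closure occur here; they agree because such a structure is
    -- unique.
    rw [Subsingleton.elim (DivisionRing.toRatAlgebra : Algebra ℚ (AlgebraicClosure ℚ))
      (AlgebraicClosure.instAlgebra ℚ)]
    exact AlgebraicClosure.isAlgebraic ℚ
  have : Normal ℚ (AlgebraicClosure ℚ) := (IsAlgClosure.mk (R := ℚ) inferInstance this).normal
  obtain ⟨x, hx, hne⟩ := exists_seq_isRamifiedPair
  have hspec : ∀ i, Irreducible (chebyshevSeptic ((x i).2 : ℚ) 1) ∧
      Nonempty ((chebyshevSeptic ((x i).2 : ℚ) 1).Gal ≃* C7C3) := fun i => by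
    have := specialization_of_no_root (r := (x i).2) (s := 1) (by rw [mul_one]; exact (hx i).2.2.2.1)
      fun t => by
        rw [Int.cast_one]
        exact (hx i).eval_ne_zero (R := ℤ) (Nat.prime_iff_prime_int.1 (hx i).1)
          (fun n => by simp) t
    rwa [Int.cast_one] at this
  have hroot : ∀ i, ∃ a : AlgebraicClosure ℚ, aeval a (chebyshevSeptic ((x i).2 : ℚ) 1) = 0 :=
    fun i => IsAlgClosed.exists_aeval_eq_zero _ _
      (degree_pos_of_irreducible (hspec i).1).ne'
  choose a ha using hroot
  have key : ∀ i j, i < j →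
      IsEmpty (IntermediateField.adjoin ℚ {a j} →+* IntermediateField.adjoin ℚ {a i}) := by
    refine fun i j hij => ⟨fun e => ?_⟩
    have : Fact (x j).1.Prime := ⟨(hx j).1⟩
    -- The earlier field embeds in `ℚ_p` for the later prime `p`. An embedding of the later field
    -- into it would carry a root of the later septic into `ℚ_p`, where there is none.
    obtain ⟨b, hb⟩ := exists_padic_root (hx j).2.1 (hx j).2.2.1 (hne i j hij)
    obtain ⟨ι⟩ := nonempty_algHom_of_root (hspec i).1 (ha i) (b := b)
      (by rw [aeval_chebyshevSeptic]; simpa using hb)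
    have hgen : (chebyshevSeptic ((x j).2 : IntermediateField.adjoin ℚ {a j}) 1).eval
        (IntermediateField.AdjoinSimple.gen ℚ (a j)) = 0 := by
      have := ha j
      rw [aeval_chebyshevSeptic] at this
      apply (algebraMap (IntermediateField.adjoin ℚ {a j}) (AlgebraicClosure ℚ)).injective
      rw [← eval_map_apply, map_chebyshevSeptic, map_zero,
        IntermediateField.AdjoinSimple.algebraMap_gen]
      simpa using this
    refine (hx j).eval_ne_zero (R := ℤ_[(x j).1]) (K := ℚ_[(x j).1]) PadicInt.prime_p
      (fun n => ?_) (((ι : _ →+* ℚ_[(x j).1]).comp e) (IntermediateField.AdjoinSimple.gen ℚ (a j))) ?_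
    · rw [← PadicInt.norm_lt_one_iff_dvd, PadicInt.norm_int_lt_one_iff_dvd]
    · have := congrArg ((ι : _ →+* ℚ_[(x j).1]).comp e) hgen
      rwa [← eval_map_apply, map_chebyshevSeptic, map_zero, map_one, map_intCast] at this
  refine ⟨fun i => IntermediateField.adjoin ℚ {a i}, fun i j hij => ⟨fun e => ?_⟩,
    fun i => ⟨?_, ?_, (x i).2, 1, a i, isCoprime_one_right, ?_, ?_, rfl⟩⟩
  · rcases hij.lt_or_gt with h | h
    · exact (key i j h).false (e.symm : _ →+* _)
    · exact (key j i h).false (e : _ →+* _)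
  · have hirr := (hspec i).1
    rw [IntermediateField.adjoin.finrank (Algebra.IsIntegral.isIntegral (a i)),
      ← minpoly.eq_of_irreducible hirr (ha i),
      natDegree_mul_C (inv_ne_zero (leadingCoeff_ne_zero.2 hirr.ne_zero)),
      natDegree_chebyshevSeptic]
  · obtain ⟨ε⟩ := nonempty_splittingField_algEquiv_normalClosure (hspec i).1 (ha i)
    obtain ⟨θ⟩ := (hspec i).2
    exact ⟨(AlgEquiv.autCongr ε).symm.trans θ⟩
  · rw [mul_one]
    exact (hx i).2.2.2.1
  · rw [Int.cast_one]
    exact ha i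

open Polynomial IntermediateField in
theorem mainTheorem3 :
    -- the generic Galois group
    Nonempty ((chebyshevSeptic varU varV).Gal ≃* C7C3) ∧
    -- the specialisations at integers
    (∃ Z : Set (Fin 2 → ℚ), IsThin Z ∧
      ∀ r s : ℤ, IsCoprime r s → ¬ (7 ∣ r * s) → ![(r : ℚ), (s : ℚ)] ∉ Z →
        Irreducible (chebyshevSeptic (r : ℚ) (s : ℚ)) ∧
        Nonempty ((chebyshevSeptic (r : ℚ) (s : ℚ)).Gal ≃* C7C3)) ∧
    -- infinitely many septic fields, generated by roots of such specialisations
    (∃ K : ℕ → IntermediateField ℚ (AlgebraicClosure ℚ),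
      (∀ i j, i ≠ j → IsEmpty (K i ≃+* K j)) ∧
      ∀ i,
        Module.finrank ℚ (K i) = 7 ∧
        Nonempty ((normalClosure ℚ (K i) (AlgebraicClosure ℚ) ≃ₐ[ℚ]
          normalClosure ℚ (K i) (AlgebraicClosure ℚ)) ≃* C7C3) ∧
        ∃ (r s : ℤ) (a : AlgebraicClosure ℚ), IsCoprime r s ∧ ¬ (7 ∣ r * s) ∧
          aeval a (chebyshevSeptic (r : ℚ) (s : ℚ)) = 0 ∧ K i = ℚ⟮a⟯) :=
  ⟨nonempty_gal_generic_mulEquiv,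
    ⟨septicRootSet, isThin_septicRootSet, fun _ _ _ h hZ =>
      specialization_of_no_root h fun x hx => hZ ⟨x, hx⟩⟩,
    exists_septic_fields⟩
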